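/- Let $R$ be a commutative ring in which $2$ is invertible (for example a field of characteristic $\neq 2$), and let $A$ be a unital Jordan algebra over $R$, i.e. a unital, commutative, not necessarily associative $R$-algebra with $(ab)a^2=a(ba^2)$ for all $a,b\in A$. For $a,b\in A$ and $S\subseteq A$ put $$U_ab=2(ab)a-a^2b,\qquad U_a(A)=\{U_ax:x\in A\},\qquad A_+=\{a^2:a\in A\},\qquad U_a(A)_+=U_a(A)\cap A_+,$$ $$S^\perp=\{a\in A: U_ax=0\ \ \forall x\in S\},\qquad {}^\perp S=\{x\in A: U_ax=0\ \ \forall a\in S\},\qquad {}^\perp S_+={}^\perp S\cap A_+.$$ Suppose that $A$ has no nonzero nilpotent elements, i.e. $a^n=0$ with $n\ge 1$ implies $a=0$, where $a^1=a$ and $a^{n+1}=a\,a^n$. Then the following conditions are equivalent: (A1) for every $x\in A_+$ there exists an idempotent $e\in A$ such that $\{x\}^\perp=U_e(A)$; (B1) for every $x\in A$ there exists an idempotent $e\in A$ such that ${}^\perp\{x\}_+=U_e(A)_+$. -/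

import Mathlib

namespace JordanAlg

section Defs

variable {A : Type*} [NonAssocCommRing A]

/-- The powers `a ^ 0 = 1`, `a ^ (n + 1) = a * a ^ n` of an element of a unital (non-associative)
commutative ring. -/
def power (a : A) : ℕ → A
  | 0 => 1
  | n + 1 => a * power a n

/-- The element `a` is nilpotent: some power `a ^ n` with `n ≥ 1` vanishes. -/
def IsNilp (a : A) : Prop := ∃ n : ℕ, 1 ≤ n ∧ power a n = 0

variable (A) in
/-- `A` has no nilpotent elements apart from `0`. -/
def NoNilpotents : Prop := ∀ a : A, IsNilp a → a = 0

variable (A) in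
/-- The set `A₊` of squares. -/
def squares : Set A := {x | ∃ a : A, x = a * a}

/-- The quadratic operator `U_a b = 2 (a b) a - a² b`. -/
def U (a b : A) : A := 2 • ((a * b) * a) - (a * a) * b

/-- `U_a(A) = {U_a x : x ∈ A}`. -/
def URange (a : A) : Set A := {y | ∃ x : A, y = U a x}

/-- `U_a(A)₊ = U_a(A) ∩ A₊`. -/
def URangePos (a : A) : Set A := URange a ∩ squares A

/-- `S^⊥ = {a ∈ A : U_a x = 0 for all x ∈ S}`. -/
def perpRight (S : Set A) : Set A := {a | ∀ x ∈ S, U a x = 0}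

/-- `^⊥S = {x ∈ A : U_a x = 0 for all a ∈ S}`. -/
def perpLeft (S : Set A) : Set A := {x | ∀ a ∈ S, U a x = 0}

/-- `^⊥S₊ = ^⊥S ∩ A₊`. -/
def perpLeftPos (S : Set A) : Set A := perpLeft S ∩ squares A

variable (A) in
/-- Condition (A1): for every `x ∈ A₊` there is an idempotent `e` with `{x}^⊥ = U_e(A)`. -/
def CondA1 : Prop :=
  ∀ x ∈ squares A, ∃ e : A, IsIdempotentElem e ∧ perpRight {x} = URange e

variable (A) in
/-- Condition (B1): for every `x ∈ A` there is an idempotent `e` with `^⊥{x}₊ = U_e(A)₊`. -/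
def CondB1 : Prop :=
  ∀ x : A, ∃ e : A, IsIdempotentElem e ∧ perpLeftPos {x} = URangePos e

end Defs

end JordanAlg

/-!
Write `{x, y, z} = (x y) z + x (y z) - y (x z)`, so that `U_x y = {x, y, x}`. Operator identities
for this triple product give the fundamental formula `U_{U_x y} = U_x U_y U_x`; applied to `1` it
reads `(U_x y)² = U_x (U_y x²)`. If no nonzero element squares to zero, it follows that
`U_a c² = 0` is equivalent to `U_c a² = 0`, and that it forces `a c = 0`. By the first fact, `c²`
lies in `^⊥{x}` if and only if `c` lies in `{x²}^⊥`. By the second, applied with `a = 1 - e` for an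
idempotent `e`, `c²` lies in `U_e(A)` if and only if `c` does. So `{x²}^⊥ = U_e(A)` and
`^⊥{x}₊ = U_e(A)₊` are equivalent for each `x` and `e` separately.
-/

namespace JordanAlg

local notation "L" => AddMonoid.End.mulLeft

theorem isSMulRegular_addMonoidEnd {M : Type*} [AddCommMonoid M] {n : ℕ}
    (h : IsSMulRegular M n) : IsSMulRegular (AddMonoid.End M) n :=
  fun _ _ hfg => AddMonoidHom.ext fun a => h (DFunLike.congr_fun hfg a)

section TripleProduct

variable {A : Type*} [NonAssocCommRing A]

/-- The operator `y ↦ {x, y, z}` of the Jordan triple product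
`{x, y, z} = (x y) z + x (y z) - y (x z)`, biadditive in `x` and `z`. The normalisation is the one
with `{x, y, x} = U_x y`. -/
def quadOp : A →+ A →+ AddMonoid.End A :=
  let LL := (AddMonoidHom.mul.comp L).compl₂ (L : A →+ AddMonoid.End A)
  LL + LL.flip - AddMonoidHom.mul.compr₂ L

/-- The operator `z ↦ {x, y, z}` of the same triple product, biadditive in `x` and `y`. -/
def boxOp : A →+ A →+ AddMonoid.End A :=
  let LL := (AddMonoidHom.mul.comp L).compl₂ (L : A →+ AddMonoid.End A)
  AddMonoidHom.mul.compr₂ L + LL - LL.flip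

theorem quadOp_def (x z : A) : quadOp x z = L x * L z + L z * L x - L (x * z) := rfl

theorem boxOp_def (x y : A) : boxOp x y = L (x * y) + L x * L y - L y * L x := rfl

theorem quadOp_comm (x z : A) : quadOp x z = quadOp z x := by
  rw [quadOp_def, quadOp_def, mul_comm x z, add_comm (L x * L z)]

theorem boxOp_apply_eq_quadOp_apply (x y z : A) : boxOp x y z = quadOp x z y := by
  change x * y * z + x * (y * z) - y * (x * z) = x * (z * y) + z * (x * y) - x * z * y
  rw [mul_comm z y, mul_comm z (x * y), mul_comm (x * z) y, add_comm (x * y * z)]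

theorem quadOp_self_apply (x y : A) : quadOp x x y = U x y := by
  change x * (x * y) + x * (x * y) - x * x * y = U x y
  rw [U, two_nsmul, mul_comm (x * y) x]

theorem boxOp_apply_self (x y : A) : boxOp x y x = U x y := by
  rw [boxOp_apply_eq_quadOp_apply, quadOp_self_apply]

theorem U_add (x z y : A) : U (x + z) y = U x y + U z y + 2 • boxOp x y z := by
  change _ = _ + 2 • (x * y * z + x * (y * z) - y * (x * z))
  simp only [U, add_mul, mul_add, two_nsmul, mul_comm z x, mul_comm y z, mul_comm x (z * y),
    mul_comm y (x * z)]
  abel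

theorem U_sub (x z y : A) : U (x - z) y = U x y + U z y - 2 • boxOp x y z := by
  change _ = _ - 2 • (x * y * z + x * (y * z) - y * (x * z))
  simp only [U, sub_mul, mul_sub, two_nsmul, mul_comm z x, mul_comm y z, mul_comm x (z * y),
    mul_comm y (x * z)]
  abel

theorem U_zero_right (a : A) : U a 0 = 0 := by
  rw [← quadOp_self_apply, map_zero]

theorem U_one_right (a : A) : U a 1 = a * a := by
  rw [U, mul_one, mul_one, two_nsmul, add_sub_cancel_right]

theorem U_one_left (a : A) : U 1 a = a := by
  rw [U, one_mul, mul_one, mul_one, one_mul, two_nsmul, add_sub_cancel_right]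

theorem eq_zero_of_mul_self (hA : NoNilpotents A) {a : A} (h : a * a = 0) : a = 0 :=
  hA a ⟨2, one_le_two, by rw [power, power, power, mul_one, h]⟩

end TripleProduct

section Jordan

variable {A : Type*} [NonAssocCommRing A] [IsCommJordan A]

theorem U_mul_self (x y : A) : U x y * x = U x (x * y) := by
  have h : x * (x * x * y) = x * x * (x * y) := DFunLike.congr_fun (commute_lmul_lmul_sq x).eq y
  rw [U, U, mul_comm _ x, mul_sub, h, mul_smul_comm, mul_comm x (x * y), mul_comm x (x * y * x)]

theorem lie_mulLeft_mulLeft_mul_cyclic (h2 : IsSMulRegular A (2 : ℕ)) (a b c : A) :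
    ⁅L a, L (b * c)⁆ + ⁅L b, L (c * a)⁆ + ⁅L c, L (a * b)⁆ = 0 :=
  (isSMulRegular_addMonoidEnd h2).right_eq_zero_of_smul
    (two_nsmul_lie_lmul_lmul_add_add_eq_zero a b c)

theorem mulLeft_sq_commutator (h2 : IsSMulRegular A (2 : ℕ)) (a b : A) :
    L (a * a) * L b - L b * L (a * a) = 2 • (L a * L (a * b) - L (a * b) * L a) := by
  have h := lie_mulLeft_mulLeft_mul_cyclic h2 a a b
  simp only [Ring.lie_def, mul_comm b a] at h
  linear_combination (norm := noncomm_ring) -h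

theorem mulLeft_mul_mul (h2 : IsSMulRegular A (2 : ℕ)) (a b c : A) :
    L (a * b * c) = L (a * b) * L c + L (b * c) * L a + L (c * a) * L b
      - L a * L c * L b - L b * L c * L a := by
  ext d
  have h := DFunLike.congr_fun (lie_mulLeft_mulLeft_mul_cyclic h2 a b d) c
  change a * (b * d * c) - b * d * (a * c) + (b * (d * a * c) - d * a * (b * c))
    + (d * (a * b * c) - a * b * (d * c)) = 0 at h
  change a * b * c * d = a * b * (c * d) + b * c * (a * d) + c * a * (b * d)
    - a * (c * (b * d)) - b * (c * (a * d))
  rw [mul_comm _ d, mul_comm c d, mul_comm c a, mul_comm c (b * d), mul_comm c (a * d),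
    mul_comm a d, mul_comm (b * c), mul_comm (a * c)]
  rw [← sub_eq_zero, ← h]
  abel

theorem mulLeft_U (h2 : IsSMulRegular A (2 : ℕ)) (x y : A) :
    L (U x y) = 2 • (L (x * y) * L x) + L (x * x) * L y
      + 2 • (L x * L y * L x - L x * L x * L y - L y * L x * L x) := by
  simp only [U, map_sub, map_nsmul, mulLeft_mul_mul h2, mul_comm y x]
  noncomm_ring

theorem boxOp_mul_quadOp_self (h2 : IsSMulRegular A (2 : ℕ)) (x y : A) :
    boxOp x y * quadOp x x = quadOp (U x y) x := by
  have hx : L (x * x) * L x = L x * L (x * x) := (commute_lmul_lmul_sq x).eq.symm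
  have hxy := mulLeft_sq_commutator h2 x y
  have hxxy := mulLeft_sq_commutator h2 x (x * y)
  rw [mul_comm x (x * y), mulLeft_mul_mul h2, mul_comm y x] at hxxy
  simp only [boxOp_def, quadOp_def, U_mul_self, mulLeft_U h2, mul_comm x (x * y),
    mulLeft_mul_mul h2, mul_comm y x]
  -- Both sides are now polynomials in `L x`, `L y`, `L (x * x)` and `L (x * y)`, and they agree
  -- modulo the commutation relations `hx`, `hxy` and `hxxy`.
  linear_combination (norm := noncomm_ring) L x * hxy - hxy * L x - L y * hx + hxxy

theorem boxOp_U_left (h2 : IsSMulRegular A (2 : ℕ)) (x y : A) :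
    boxOp (U x y) y = boxOp x (U y x) := by
  have hxy := mulLeft_sq_commutator h2 x y
  have hyx := mulLeft_sq_commutator h2 y x
  have hxyy := mulLeft_sq_commutator h2 x (y * y)
  rw [mul_comm x (y * y), mulLeft_mul_mul h2] at hxyy
  rw [boxOp_def, boxOp_def, mulLeft_U h2, mulLeft_U h2]
  simp only [U, two_nsmul, add_mul, sub_mul, mul_add, mul_sub, map_add, map_sub,
    mulLeft_mul_mul h2, mul_comm y x, mul_comm x (_ * _), mul_comm y (_ * _)] at hyx hxyy ⊢
  linear_combination (norm := noncomm_ring) -L y * hxy + L x * hyx + hxyy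

theorem two_nsmul_boxOp_mul_self (h2 : IsSMulRegular A (2 : ℕ)) (x y : A) :
    2 • (boxOp x y * boxOp x y) = boxOp x (U y x) + quadOp x x * quadOp y y := by
  have hyx := mulLeft_sq_commutator h2 y x
  rw [boxOp_def x (U y x), mulLeft_U h2]
  simp only [U, boxOp_def, quadOp_def, two_nsmul, mul_add, mul_sub, map_add, map_sub,
    mulLeft_mul_mul h2, mul_comm y x, mul_comm x (_ * _)] at hyx ⊢
  linear_combination (norm := noncomm_ring) -L x * hyx

theorem boxOp_mul_quadOp_linearized (h2 : IsSMulRegular A (2 : ℕ)) (x y z : A) :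
    boxOp z y * quadOp x x + 2 • (boxOp x y * quadOp x z) =
      quadOp (U x y) z + 2 • quadOp (boxOp x y z) x := by
  -- Comparing `x + z` with `x - z` isolates the part of odd degree in `z`; its cubic term is `hz`.
  have hadd := boxOp_mul_quadOp_self h2 (x + z) y
  have hsub := boxOp_mul_quadOp_self h2 (x - z) y
  have hz := boxOp_mul_quadOp_self h2 z y
  simp only [U_add, U_sub, map_add, map_sub, map_nsmul, AddMonoidHom.add_apply,
    AddMonoidHom.sub_apply, AddMonoidHom.nsmul_apply, quadOp_comm z x] at hadd hsub
  apply isSMulRegular_addMonoidEnd h2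
  linear_combination (norm := noncomm_ring) hadd - hsub - 2 * hz

theorem boxOp_apply_U (h2 : IsSMulRegular A (2 : ℕ)) (x y : A) :
    boxOp x y (U x y) = U x (U y x) := by
  apply h2
  have h := DFunLike.congr_fun (two_nsmul_boxOp_mul_self h2 x y) x
  change 2 • boxOp x y (boxOp x y x) = boxOp x (U y x) x + quadOp x x (quadOp y y x) at h
  simpa only [boxOp_apply_self, quadOp_self_apply, ← two_nsmul] using h

theorem quadOp_U_self (h2 : IsSMulRegular A (2 : ℕ)) (x y : A) :
    quadOp (U x y) (U x y) = quadOp x x * quadOp y y * quadOp x x := by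
  have h := boxOp_mul_quadOp_linearized h2 x y (U x y)
  rw [boxOp_apply_U h2, boxOp_U_left h2, quadOp_comm x (U x y), ← boxOp_mul_quadOp_self h2,
    ← boxOp_mul_quadOp_self h2] at h
  linear_combination (norm := noncomm_ring) two_nsmul_boxOp_mul_self h2 x y * quadOp x x - h

theorem U_fundamental_formula (h2 : IsSMulRegular A (2 : ℕ)) (x y z : A) :
    U (U x y) z = U x (U y (U x z)) := by
  have h := DFunLike.congr_fun (quadOp_U_self h2 x y) z
  simpa only [AddMonoid.End.coe_mul, Function.comp_apply, quadOp_self_apply] using h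

theorem U_mul_U (h2 : IsSMulRegular A (2 : ℕ)) (x y : A) : U x y * U x y = U x (U y (x * x)) := by
  rw [← U_one_right (U x y), U_fundamental_formula h2, U_one_right]

theorem U_sq_left (h2 : IsSMulRegular A (2 : ℕ)) (x y : A) : U (x * x) y = U x (U x y) := by
  rw [← U_one_right x, U_fundamental_formula h2, U_one_left]

theorem four_nsmul_mul_sq (h2 : IsSMulRegular A (2 : ℕ)) (a c : A) :
    4 • (a * c * (a * c)) = 2 • (c * U a c) + U a (c * c) + U c (a * a) := by
  have h := DFunLike.congr_fun (mulLeft_mul_mul h2 c c a) a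
  change c * c * a * a = c * c * (a * a) + c * a * (c * a) + a * c * (c * a)
    - c * (a * (c * a)) - c * (a * (c * a)) at h
  simp only [U, mul_add, mul_sub, two_nsmul, mul_comm c a, mul_comm c (_ * _),
    mul_comm a (_ * _)] at h ⊢
  rw [mul_comm (c * c) (a * a)] at h ⊢
  rw [h]
  abel

theorem mul_U_of_isIdempotentElem (h2 : IsSMulRegular A (2 : ℕ)) {e : A} (he : IsIdempotentElem e)
    (x : A) :
    e * U e x = U e x := by
  have h := DFunLike.congr_fun (mulLeft_mul_mul h2 e e e) x
  change e * e * e * x = e * e * (e * x) + e * e * (e * x) + e * e * (e * x)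
    - e * (e * (e * x)) - e * (e * (e * x)) at h
  rw [he.eq, he.eq] at h
  rw [U, he.eq, mul_sub, two_nsmul, mul_add, mul_comm (e * x) e]
  rw [← sub_eq_zero] at h ⊢
  rw [← h]
  abel

theorem mem_URange_iff_mul_eq (h2 : IsSMulRegular A (2 : ℕ)) {e : A} (he : IsIdempotentElem e)
    {x : A} :
    x ∈ URange e ↔ e * x = x := by
  constructor
  · rintro ⟨y, rfl⟩
    exact mul_U_of_isIdempotentElem h2 he y
  · intro h
    exact ⟨x, by rw [U, he.eq, h, mul_comm, h, two_nsmul, add_sub_cancel_right]⟩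

theorem sq_mem_URange (h2 : IsSMulRegular A (2 : ℕ)) {a x : A} (hx : x ∈ URange a) :
    x * x ∈ URange a := by
  obtain ⟨y, rfl⟩ := hx
  exact ⟨U y (a * a), U_mul_U h2 a y⟩

theorem U_sq_right_eq_zero_comm (h2 : IsSMulRegular A (2 : ℕ)) (hA : NoNilpotents A) {a c : A} :
    U a (c * c) = 0 ↔ U c (a * a) = 0 := by
  have symm {a c : A} (h : U a (c * c) = 0) : U c (a * a) = 0 := by
    apply eq_zero_of_mul_self hA
    rw [U_mul_U h2, U_sq_left h2, h, U_zero_right, U_zero_right]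
  exact ⟨symm, symm⟩

theorem mul_eq_zero_of_U_sq_right_eq_zero (h2 : IsSMulRegular A (2 : ℕ)) (hA : NoNilpotents A)
    {a c : A} (h : U a (c * c) = 0) : a * c = 0 := by
  have h' : U c (a * a) = 0 := (U_sq_right_eq_zero_comm h2 hA).1 h
  have hac : U a c = 0 := by
    apply eq_zero_of_mul_self hA
    rw [U_mul_U h2, h', U_zero_right]
  have h4 : 4 • (a * c * (a * c)) = 0 := by
    rw [four_nsmul_mul_sq h2, hac, h, h', mul_zero, smul_zero, add_zero, add_zero]
  exact eq_zero_of_mul_self hA ((h2.mul h2).right_eq_zero_of_smul h4)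

theorem sq_mem_URange_iff (h2 : IsSMulRegular A (2 : ℕ)) (hA : NoNilpotents A) {e c : A}
    (he : IsIdempotentElem e) :
    c * c ∈ URange e ↔ c ∈ URange e := by
  refine ⟨fun h => ?_, sq_mem_URange h2⟩
  rw [mem_URange_iff_mul_eq h2 he] at h ⊢
  have hcc : (1 - e) * (c * c) = 0 := by rw [sub_mul, one_mul, h, sub_self]
  have hU : U (1 - e) (c * c) = 0 := by
    rw [U, he.one_sub.eq, hcc, zero_mul, smul_zero, sub_zero]
  have hc : (1 - e) * c = 0 := mul_eq_zero_of_U_sq_right_eq_zero h2 hA hU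
  rw [sub_mul, one_mul, sub_eq_zero] at hc
  exact hc.symm

theorem sq_mem_perpLeft_singleton_iff (h2 : IsSMulRegular A (2 : ℕ)) (hA : NoNilpotents A)
    {x c : A} :
    c * c ∈ perpLeft {x} ↔ c ∈ perpRight {x * x} := by
  simp only [perpLeft, perpRight, Set.mem_ofPred_eq, Set.mem_singleton_iff, forall_eq]
  exact U_sq_right_eq_zero_comm h2 hA

theorem perpRight_sq_eq_URange_iff (h2 : IsSMulRegular A (2 : ℕ)) (hA : NoNilpotents A) {x e : A}
    (he : IsIdempotentElem e) :
    perpRight {x * x} = URange e ↔ perpLeftPos {x} = URangePos e := by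
  have hroots : perpLeftPos {x} = URangePos e ↔
      ∀ c : A, c * c ∈ perpLeft {x} ↔ c * c ∈ URange e := by
    simp only [perpLeftPos, URangePos, Set.ext_iff, Set.mem_inter_iff, and_congr_left_iff]
    exact ⟨fun h c => h _ ⟨c, rfl⟩, fun h _ ⟨c, hc⟩ => hc ▸ h c⟩
  simp only [hroots, sq_mem_perpLeft_singleton_iff h2 hA, sq_mem_URange_iff h2 hA he,
    Set.ext_iff]

end Jordan

end JordanAlg

theorem theorem1p7_general {A : Type*} [NonAssocCommRing A] [IsCommJordan A]
    (h2 : IsSMulRegular A (2 : ℕ)) (hA : JordanAlg.NoNilpotents A) :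
    JordanAlg.CondA1 A ↔ JordanAlg.CondB1 A := by
  constructor
  · intro hA1 x
    obtain ⟨e, he, hx⟩ := hA1 (x * x) ⟨x, rfl⟩
    exact ⟨e, he, (JordanAlg.perpRight_sq_eq_URange_iff h2 hA he).1 hx⟩
  · rintro hB1 _ ⟨x, rfl⟩
    obtain ⟨e, he, hx⟩ := hB1 x
    exact ⟨e, he, (JordanAlg.perpRight_sq_eq_URange_iff h2 hA he).2 hx⟩

theorem theorem1p7 {R A : Type*} [CommRing R] (h2 : IsUnit (2 : R))
    [NonAssocCommRing A] [Module R A] [IsScalarTower R A A] [SMulCommClass R A A]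
    [IsCommJordan A] (hA : JordanAlg.NoNilpotents A) :
    JordanAlg.CondA1 A ↔ JordanAlg.CondB1 A :=
  theorem1p7_general
    (.of_map Nat.cast (Nat.cast_smul_eq_nsmul R 2) (by simpa using h2.isSMulRegular A)) hA
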